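/- Consider two-party communication protocols in which Alice holds $x\in\mathcal X$, Bob holds $y\in\mathcal Y$, they exchange bits over any number of rounds, and at the end one of the players declares an output in $\{0,1\}$. In a randomized protocol the players' actions may also depend on a common random source; its communication cost is the maximum, over the inputs and the values of the random source, of the total number of bits sent. For $f\colon\mathcal X\times\mathcal Y\to\{0,1\}$ and $\delta>0$ let $R_\delta(f)$ be the minimum cost of a randomized protocol which, on every input $(x,y)$, outputs a value different from $f(x,y)$ with probability at most $\delta$. Let $\mathrm{Ham}^n_k\colon\{0,1\}^n\times\{0,1\}^n\to\{0,1\}$ be the $k$-Hamming distance problem: $\mathrm{Ham}^n_k(x,y)=1$ if and only if $x$ and $y$ differ in at most $k$ positions. Theorem. For every $\delta_0<1/2$ there is a constant $c>0$, depending only on $\delta_0$, such that for all integers $n,k\ge 0$ and all real $\delta$ with $0<\delta\le\delta_0$ and $k^2\le\delta n$, $$R_\delta(\mathrm{Ham}^n_k)\ \ge\ c\,k\log(1/\delta).$$ The same lower bound holds for the cost of randomized protocols that are only required to err with probability at most $\delta$ on the inputs $(x,y)$ whose Hamming distance is exactly $k$ or exactly $k+2$, and that may output an arbitrary answer on all other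 inputs. -/

import Mathlib

open MeasureTheory

/-- A deterministic two-party communication protocol, as a protocol tree. At a `send` node the
owner of the node sends one bit, a function of the owner's input, and both players continue in the
subtree selected by this bit (a longer message is a run of consecutive nodes of one player). At
an `out` leaf the communication is over and one of the players declares the output, which may
depend on the input of that player. -/
inductive CommTree (X Y : Type) : Type where
  | aliceOut (f : X → Bool) : CommTree X Y
  | bobOut (g : Y → Bool) : CommTree X Y
  | aliceSend (f : X → Bool) (next : Bool → CommTree X Y) : CommTree X Y
  | bobSend (g : Y → Bool) (next : Bool → CommTree X Y) : CommTree X Y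

namespace CommTree

variable {X Y : Type}

/-- The output of the protocol when Alice holds `x` and Bob holds `y`. -/
def run : CommTree X Y → X → Y → Bool
  | aliceOut f, x, _ => f x
  | bobOut g, _, y => g y
  | aliceSend f next, x, y => (next (f x)).run x y
  | bobSend g next, x, y => (next (g y)).run x y

/-- The total number of bits sent when Alice holds `x` and Bob holds `y`. -/
def bitsSent : CommTree X Y → X → Y → ℕ
  | aliceOut _, _, _ => 0
  | bobOut _, _, _ => 0
  | aliceSend f next, x, y => (next (f x)).bitsSent x y + 1
  | bobSend g next, x, y => (next (g y)).bitsSent x y + 1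

end CommTree

/-- A randomized (public-coin) protocol: a common random source, and a deterministic protocol for
each of its values, such that the output on every input is a random variable. There is no bound
on the number of rounds. -/
structure RandProtocol (X Y : Type) where
  /-- the values of the common random source -/
  Ω : Type
  /-- the events -/
  mΩ : MeasurableSpace Ω
  /-- the law of the random source -/
  μ : Measure Ω
  /-- the law is a probability measure -/
  isProb : IsProbabilityMeasure μ
  /-- the deterministic protocol that is followed for a given value of the source -/
  tree : Ω → CommTree X Y
  /-- the output on each input is a random variable -/
  measurableSet_run : ∀ x y, MeasurableSet {ω | (tree ω).run x y = true}

namespace RandProtocol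

variable {X Y : Type}

/-- The communication cost: the maximum, over the inputs and the random source, of the total
number of bits sent (`⊤` if unbounded). -/
noncomputable def cost (P : RandProtocol X Y) : ℕ∞ :=
  ⨆ (ω : P.Ω) (x : X) (y : Y), ((P.tree ω).bitsSent x y : ℕ∞)

/-- The probability that the output on input `(x, y)` differs from `f x y`. -/
noncomputable def errorProb (P : RandProtocol X Y) (f : X → Y → Bool) (x : X) (y : Y) : ℝ :=
  (@Measure.real P.Ω P.mΩ P.μ {ω | (P.tree ω).run x y ≠ f x y})

end RandProtocol

/-- The `δ`-error randomized communication complexity of the function `f` under the promise that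
the input lies in `D`: the minimum cost of a randomized protocol that errs with probability at
most `δ` on every input in `D`, and may answer arbitrarily on all other inputs. -/
noncomputable def randCCOn {X Y : Type} (D : Set (X × Y)) (δ : ℝ) (f : X → Y → Bool) : ℕ∞ :=
  ⨅ (P : RandProtocol X Y) (_ : ∀ x y, (x, y) ∈ D → P.errorProb f x y ≤ δ), P.cost

/-- The `δ`-error randomized communication complexity `R_δ(f)` of `f`. -/
noncomputable def randCC {X Y : Type} (δ : ℝ) (f : X → Y → Bool) : ℕ∞ :=
  randCCOn Set.univ δ f

/-- The `k`-Hamming distance problem on strings of length `n`: the answer is `1` if and only if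
`x` and `y` differ in at most `k` positions. -/
def hamProblem (n k : ℕ) (x y : Fin n → Bool) : Bool :=
  decide (hammingDist x y ≤ k)

/-- The pairs of strings of length `n` at Hamming distance exactly `k` or exactly `k + 2`. -/
def hamPromise (n k : ℕ) : Set ((Fin n → Bool) × (Fin n → Bool)) :=
  {p | hammingDist p.1 p.2 = k ∨ hammingDist p.1 p.2 = k + 2}

/-! A deterministic protocol of cost `C` accepts a disjoint union of at most `2 ^ C` rectangles. For
indicators `u`, `v` of the sides of one rectangle and a symmetric nonnegative matrix `S`,
`blakley_dixon` bounds `⟨u, S ^ k v⟩` by `⟨u, S ^ (k + 2) v⟩` and the area of the rectangle: a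
rectangle caught often by walks of `k` steps is also caught by walks of `k + 2` steps. Summing over
the rectangles in Hölder's manner and averaging over the random source gives `p ^ (k + 2) ≤ q ^ k *
2 ^ C` (`RandProtocol.walk_bound`), where `p` and `q` are a lower and an upper bound for the
acceptance probabilities after `k` and `k + 2` steps.

Take for `S` the walk on the cube that flips one random coordinate per step. By a birthday estimate,
walks much shorter than the square root of the number of coordinates rarely flip a coordinate twice,
so they end at distance equal to their length. Thus `p` is near `1 - δ` and `q` near `δ`, and taking
logarithms bounds `C` from below.

For small `δ` the collision probability is `O(δ)` and all `k` differences come from the walk. For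
`δ` near `1 / 2` it has to be a small constant, so only a constant fraction of the differences comes
from the walk and the others are fixed negations (`RandProtocol.hamming_bound`). Bounded `k` is
covered by the need for at least one bit. -/

/-- The log-sum inequality. -/
theorem sum_mul_log_div_le {α : Type*} (s : Finset α) (p q : α → ℝ)
    (hp : ∀ i ∈ s, 0 ≤ p i) (hq : ∀ i ∈ s, 0 ≤ q i) (hpq : ∀ i ∈ s, 0 < p i → 0 < q i)
    (hs : 0 < ∑ i ∈ s, p i) :
    ∑ i ∈ s, p i * Real.log (q i / p i) ≤
      (∑ i ∈ s, p i) * Real.log ((∑ i ∈ s, q i) / ∑ i ∈ s, p i) := by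
  set A := ∑ i ∈ s, p i with hA
  set B := ∑ i ∈ s, q i with hB
  obtain ⟨j, hj, hj0⟩ := Finset.exists_lt_of_sum_lt (s := s) (f := fun _ => (0 : ℝ)) (g := p)
    (by simpa using hs)
  have hBpos : 0 < B :=
    lt_of_lt_of_le (hpq j hj hj0) (Finset.single_le_sum hq hj)
  -- This is `log t ≤ t - 1` at `t = (q i / p i) / (B / A)`; the correction terms sum to zero.
  have key : ∀ i ∈ s, p i * Real.log (q i / p i) ≤
      p i * Real.log (B / A) + (q i * (A / B) - p i) := by
    intro i hi
    rcases (hp i hi).eq_or_lt with h | h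
    · rw [← h]
      have := hq i hi
      simp only [zero_mul, sub_zero, zero_add]
      positivity
    · have hqi := hpq i hi h
      have h1 := Real.log_le_sub_one_of_pos (x := q i / p i / (B / A)) (by positivity)
      rw [Real.log_div (by positivity) (by positivity)] at h1
      have h2 := mul_le_mul_of_nonneg_left h1 h.le
      have h3 : p i * (q i / p i / (B / A) - 1) = q i * (A / B) - p i := by
        field_simp
      linarith
  calc _ ≤ ∑ i ∈ s, (p i * Real.log (B / A) + (q i * (A / B) - p i)) := Finset.sum_le_sum key
    _ = A * Real.log (B / A) + (B * (A / B) - A) := by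
      rw [Finset.sum_add_distrib, Finset.sum_sub_distrib, ← Finset.sum_mul, ← Finset.sum_mul]
    _ = _ := by field_simp; ring

/-! ### The Blakley–Dixon inequality, by an entropy argument -/

section BlakleyDixon

open Matrix

variable {V : Type*} [Fintype V]

/-- The sum of `f g log (f / g)`. -/
noncomputable def logRatioSum (f g : V → ℝ) : ℝ :=
  ∑ x, f x * g x * Real.log (f x / g x)

theorem logRatioSum_swap (f g : V → ℝ) : logRatioSum f g = -logRatioSum g f := by
  unfold logRatioSum
  rw [← Finset.sum_neg_distrib]
  refine Finset.sum_congr rfl fun x _ => ?_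
  rw [← inv_div, Real.log_inv]
  ring

/-- Log-sum inequality for the weights `f v` and `v ^ 2`. It serves at both ends of the telescoping
sum in `blakley_dixon`, where the norms of `u` and `v` enter. -/
theorem mul_log_le_logRatioSum (f v : V → ℝ) (hf : 0 ≤ f) (hv : 0 ≤ v) (ha : 0 < f ⬝ᵥ v) :
    (f ⬝ᵥ v) * Real.log ((f ⬝ᵥ v) / (v ⬝ᵥ v)) ≤ logRatioSum f v := by
  have h := sum_mul_log_div_le Finset.univ (fun x => f x * v x) (fun x => v x * v x)
    (fun x _ => mul_nonneg (hf x) (hv x)) (fun x _ => mul_nonneg (hv x) (hv x))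
    (fun x _ h => by
      have : v x ≠ 0 := by rintro h0; simp [h0] at h
      exact mul_self_pos.mpr this) ha
  change _ ≤ (f ⬝ᵥ v) * Real.log ((v ⬝ᵥ v) / (f ⬝ᵥ v)) at h
  rw [← inv_div, Real.log_inv] at h
  have h2 : ∑ x, f x * v x * Real.log (v x * v x / (f x * v x)) = -logRatioSum f v := by
    unfold logRatioSum
    rw [← Finset.sum_neg_distrib]
    refine Finset.sum_congr rfl fun x _ => ?_
    by_cases hvx : v x = 0
    · simp [hvx]
    rw [mul_div_mul_right _ _ hvx, ← inv_div, Real.log_inv]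
    ring
  rw [h2] at h
  linarith

/-- Log-sum inequality on the edges `(x, y)`, for the weights `f x * S x y * g y` and `(S f) y * S x
y * (S g) x`. The logarithm of their ratio splits into a function of `y` minus a function of `x`,
and summing out the other endpoint leaves the two entropy sums. This is one step of a telescoping
sum that moves a factor `S` from `g` to `f`. -/
theorem logRatioSum_mulVec_sub_le (S : Matrix V V ℝ) (hS : S.IsSymm) (h0 : ∀ x y, 0 ≤ S x y)
    (f g : V → ℝ) (hf : 0 ≤ f) (hg : 0 ≤ g) (ha : 0 < f ⬝ᵥ S *ᵥ g) :
    0 < (S *ᵥ f) ⬝ᵥ S *ᵥ (S *ᵥ g) ∧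
    logRatioSum (S *ᵥ f) g - logRatioSum f (S *ᵥ g) ≤
      (f ⬝ᵥ S *ᵥ g) * Real.log (((S *ᵥ f) ⬝ᵥ S *ᵥ (S *ᵥ g)) / (f ⬝ᵥ S *ᵥ g)) := by
  have hsymm : ∀ x y, S x y = S y x := fun x y => hS.apply y x
  have hSf : ∀ y, 0 ≤ (S *ᵥ f) y := fun y =>
    Finset.sum_nonneg fun x _ => mul_nonneg (h0 _ _) (hf x)
  have hSg : ∀ y, 0 ≤ (S *ᵥ g) y := fun y =>
    Finset.sum_nonneg fun x _ => mul_nonneg (h0 _ _) (hg x)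
  have eA : ∑ e : V × V, f e.1 * S e.1 e.2 * g e.2 = f ⬝ᵥ S *ᵥ g := by
    simp only [Fintype.sum_prod_type, dotProduct, mulVec, Finset.mul_sum, mul_assoc]
  have eB : ∑ e : V × V, (S *ᵥ f) e.2 * S e.1 e.2 * (S *ᵥ g) e.1 =
      (S *ᵥ f) ⬝ᵥ S *ᵥ (S *ᵥ g) := by
    rw [Fintype.sum_prod_type, Finset.sum_comm]
    simp only [dotProduct]
    refine Finset.sum_congr rfl fun y _ => ?_
    change _ = (S *ᵥ f) y * ∑ x, S y x * (S *ᵥ g) x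
    rw [Finset.mul_sum]
    refine Finset.sum_congr rfl fun x _ => ?_
    rw [hsymm x y]; ring
  have pos : ∀ x y, 0 < f x * S x y * g y →
      0 < f x ∧ 0 < g y ∧ 0 < S x y ∧ 0 < (S *ᵥ f) y ∧ 0 < (S *ᵥ g) x := by
    intro x y h
    have h1 : 0 < f x := (hf x).lt_of_ne' (by rintro e; simp [e] at h)
    have h2 : 0 < g y := (hg y).lt_of_ne' (by rintro e; simp [e] at h)
    have h3 : 0 < S x y := (h0 x y).lt_of_ne' (by rintro e; simp [e] at h)
    refine ⟨h1, h2, h3, ?_, ?_⟩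
    · have := Finset.single_le_sum (f := fun x => S y x * f x)
        (fun x _ => mul_nonneg (h0 y x) (hf x)) (Finset.mem_univ x)
      refine lt_of_lt_of_le ?_ this
      rw [← hsymm x y]
      positivity
    · have := Finset.single_le_sum (f := fun y => S x y * g y)
        (fun y _ => mul_nonneg (h0 x y) (hg y)) (Finset.mem_univ y)
      refine lt_of_lt_of_le ?_ this
      positivity
  have hq0 : ∀ e : V × V, 0 ≤ (S *ᵥ f) e.2 * S e.1 e.2 * (S *ᵥ g) e.1 := fun e =>
    mul_nonneg (mul_nonneg (hSf _) (h0 _ _)) (hSg _)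
  have hpq : ∀ e : V × V, 0 < f e.1 * S e.1 e.2 * g e.2 →
      0 < (S *ᵥ f) e.2 * S e.1 e.2 * (S *ᵥ g) e.1 := by
    intro e h
    obtain ⟨_, _, h3, h4, h5⟩ := pos _ _ h
    positivity
  constructor
  · rw [← eB]
    rw [← eA] at ha
    obtain ⟨e, he, he0⟩ := Finset.exists_lt_of_sum_lt (s := Finset.univ)
      (f := fun _ => (0 : ℝ)) (g := fun e : V × V => f e.1 * S e.1 e.2 * g e.2)
      (by simpa using ha)
    exact lt_of_lt_of_le (hpq e he0)
      (Finset.single_le_sum (f := fun e : V × V => (S *ᵥ f) e.2 * S e.1 e.2 * (S *ᵥ g) e.1)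
        (fun e _ => hq0 e) he)
  · have h := sum_mul_log_div_le Finset.univ
      (fun e : V × V => f e.1 * S e.1 e.2 * g e.2)
      (fun e : V × V => (S *ᵥ f) e.2 * S e.1 e.2 * (S *ᵥ g) e.1)
      (fun e _ => mul_nonneg (mul_nonneg (hf _) (h0 _ _)) (hg _)) (fun e _ => hq0 e)
      (fun e _ => hpq e) (by rw [eA]; exact ha)
    rw [eA, eB] at h
    refine le_trans (le_of_eq ?_) h
    have split : ∀ e : V × V, f e.1 * S e.1 e.2 * g e.2 *
        Real.log ((S *ᵥ f) e.2 * S e.1 e.2 * (S *ᵥ g) e.1 / (f e.1 * S e.1 e.2 * g e.2)) =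
        (S e.2 e.1 * f e.1) * (g e.2 * Real.log ((S *ᵥ f) e.2 / g e.2)) -
        (S e.1 e.2 * g e.2) * (f e.1 * Real.log (f e.1 / (S *ᵥ g) e.1)) := by
      intro e
      rw [hsymm e.2 e.1]
      rcases (mul_nonneg (mul_nonneg (hf e.1) (h0 e.1 e.2)) (hg e.2)).eq_or_lt with hz | hz
      · rw [← hz, zero_mul]
        linear_combination (Real.log ((S *ᵥ f) e.2 / g e.2) -
          Real.log (f e.1 / (S *ᵥ g) e.1)) * hz
      · obtain ⟨h1, h2, h3, h4, h5⟩ := pos _ _ hz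
        have : (S *ᵥ f) e.2 * S e.1 e.2 * (S *ᵥ g) e.1 / (f e.1 * S e.1 e.2 * g e.2) =
            ((S *ᵥ f) e.2 / g e.2) / (f e.1 / (S *ᵥ g) e.1) := by
          field_simp
        rw [this, Real.log_div (by positivity) (by positivity)]
        ring
    rw [Finset.sum_congr rfl fun e _ => split e, Finset.sum_sub_distrib]
    congr 1
    · rw [Fintype.sum_prod_type, Finset.sum_comm]
      refine Finset.sum_congr rfl fun y _ => ?_
      dsimp only
      rw [← Finset.sum_mul, mul_assoc]
      rfl
    · rw [Fintype.sum_prod_type]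
      refine Finset.sum_congr rfl fun x _ => ?_
      dsimp only
      rw [← Finset.sum_mul, mul_comm (f x), mul_assoc]
      rfl

variable [DecidableEq V]

theorem pow_mulVec_nonneg (S : Matrix V V ℝ) (h0 : ∀ x y, 0 ≤ S x y) (f : V → ℝ) (hf : 0 ≤ f)
    (k : ℕ) : 0 ≤ S ^ k *ᵥ f := by
  induction k with
  | zero => simpa using hf
  | succ k ih =>
    rw [pow_succ', ← mulVec_mulVec]
    exact fun x => Finset.sum_nonneg fun y _ => mul_nonneg (h0 _ _) (ih y)

theorem dotProduct_pow_mulVec (S : Matrix V V ℝ) (hS : S.IsSymm) (u v : V → ℝ) (i j : ℕ) :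
    (S ^ i *ᵥ u) ⬝ᵥ (S ^ j *ᵥ v) = u ⬝ᵥ S ^ (i + j) *ᵥ v := by
  rw [pow_add, ← mulVec_mulVec, dotProduct_mulVec u, ← mulVec_transpose, transpose_pow, hS.eq]

/-- The Blakley–Dixon inequality for symmetric matrices with nonnegative entries. -/
theorem blakley_dixon (S : Matrix V V ℝ) (hS : S.IsSymm) (h0 : ∀ x y, 0 ≤ S x y)
    (u v : V → ℝ) (hu : 0 ≤ u) (hv : 0 ≤ v) (k : ℕ) (hk : 0 < k) :
    (u ⬝ᵥ S ^ k *ᵥ v) ^ (k + 2) ≤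
      (u ⬝ᵥ S ^ (k + 2) *ᵥ v) ^ k * ((u ⬝ᵥ u) * (v ⬝ᵥ v)) := by
  have nn : ∀ j f g, 0 ≤ f → 0 ≤ g → 0 ≤ f ⬝ᵥ S ^ j *ᵥ g := fun j f g hf hg =>
    dotProduct_nonneg_of_nonneg hf (pow_mulVec_nonneg S h0 g hg j)
  rcases (nn k u v hu hv).eq_or_lt with ha | ha
  · rw [← ha, zero_pow (by omega)]
    have h1 := nn (k + 2) u v hu hv
    have h2 := dotProduct_nonneg_of_nonneg hu hu
    have h3 := dotProduct_nonneg_of_nonneg hv hv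
    positivity
  set a := u ⬝ᵥ S ^ k *ᵥ v with hadef
  set b := u ⬝ᵥ S ^ (k + 2) *ᵥ v with hbdef
  -- Every `j` gives the same `a` and `b`, since only the total power of `S` matters; hence the
  -- bounds telescope.
  have step : ∀ j, j < k → 0 < b ∧
      logRatioSum (S ^ (j + 1) *ᵥ u) (S ^ (k - (j + 1)) *ᵥ v) -
        logRatioSum (S ^ j *ᵥ u) (S ^ (k - j) *ᵥ v) ≤ a * Real.log (b / a) := by
    intro j hj
    have e1 : S *ᵥ (S ^ j *ᵥ u) = S ^ (j + 1) *ᵥ u := by rw [mulVec_mulVec, ← pow_succ']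
    have e2 : S *ᵥ (S ^ (k - (j + 1)) *ᵥ v) = S ^ (k - j) *ᵥ v := by
      rw [mulVec_mulVec, ← pow_succ']; congr 3; omega
    have e3 : S *ᵥ (S ^ (k - j) *ᵥ v) = S ^ (k - j + 1) *ᵥ v := by
      rw [mulVec_mulVec, ← pow_succ']
    have h := logRatioSum_mulVec_sub_le S hS h0 (S ^ j *ᵥ u) (S ^ (k - (j + 1)) *ᵥ v)
      (pow_mulVec_nonneg S h0 u hu j) (pow_mulVec_nonneg S h0 v hv _)
    rw [e1, e2, e3, dotProduct_pow_mulVec S hS, dotProduct_pow_mulVec S hS,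
      show j + (k - j) = k by omega, show j + 1 + (k - j + 1) = k + 2 by omega] at h
    exact h ha
  have hb : 0 < b := (step 0 hk).1
  have tele : ∀ j, j ≤ k → logRatioSum (S ^ j *ᵥ u) (S ^ (k - j) *ᵥ v) -
      logRatioSum u (S ^ k *ᵥ v) ≤ j * (a * Real.log (b / a)) := by
    intro j
    induction j with
    | zero => intro _; simp
    | succ j ih =>
      intro hj
      have h1 := ih (by omega)
      have h2 := (step j (by omega)).2
      push_cast
      linarith
  have h1 := tele k le_rfl
  rw [Nat.sub_self, pow_zero, one_mulVec, logRatioSum_swap u] at h1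
  have e1 : (S ^ k *ᵥ u) ⬝ᵥ v = a := by
    simpa using dotProduct_pow_mulVec S hS u v k 0
  have e2 : (S ^ k *ᵥ v) ⬝ᵥ u = a := dotProduct_comm _ _
  have h2 := mul_log_le_logRatioSum (S ^ k *ᵥ u) v (pow_mulVec_nonneg S h0 u hu k) hv
    (by rw [e1]; exact ha)
  have h3 := mul_log_le_logRatioSum (S ^ k *ᵥ v) u (pow_mulVec_nonneg S h0 v hv k) hu
    (by rw [e2]; exact ha)
  rw [e1] at h2
  rw [e2] at h3
  have hne : ∀ w : V → ℝ, 0 ≤ w → (∃ f : V → ℝ, f ⬝ᵥ w = a) → 0 < w ⬝ᵥ w := by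
    rintro w hw ⟨f, hf⟩
    refine (dotProduct_nonneg_of_nonneg hw hw).lt_of_ne' fun h => ?_
    rw [dotProduct_self_eq_zero] at h
    rw [h, dotProduct_zero] at hf
    exact ha.ne hf
  have hu2 := hne u hu ⟨_, e2⟩
  have hv2 := hne v hv ⟨_, e1⟩
  rw [Real.log_div ha.ne' hv2.ne'] at h2
  rw [Real.log_div ha.ne' hu2.ne'] at h3
  rw [Real.log_div hb.ne' ha.ne'] at h1
  have h4 : a * ((k + 2 : ℝ) * Real.log a) ≤
      a * (k * Real.log b + (Real.log (u ⬝ᵥ u) + Real.log (v ⬝ᵥ v))) := by linarith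
  have h5 := le_of_mul_le_mul_left h4 ha
  rw [← Real.log_le_log_iff (by positivity) (by positivity), Real.log_pow,
    Real.log_mul (by positivity) (by positivity), Real.log_pow,
    Real.log_mul (by positivity) (by positivity)]
  push_cast
  exact h5

end BlakleyDixon

/-! ### Rectangle decomposition of deterministic protocols -/

namespace CommTree

variable {X Y : Type}

/-- On a rectangle where at most `C` bits are sent, the accepted inputs are a disjoint union of at
most `2 ^ C` rectangles. -/
theorem exists_rectangles (T : CommTree X Y) : ∀ (C : ℕ) (A : Set X) (B : Set Y),
    (∀ x ∈ A, ∀ y ∈ B, T.bitsSent x y ≤ C) →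
    ∃ (ι : Type) (_ : Fintype ι) (R : ι → Set X) (Q : ι → Set Y), Fintype.card ι ≤ 2 ^ C ∧
      ∀ x y, ∑ i, (R i).indicator (1 : X → ℝ) x * (Q i).indicator (1 : Y → ℝ) y =
        {p : X × Y | p.1 ∈ A ∧ p.2 ∈ B ∧ T.run p.1 p.2 = true}.indicator (1 : X × Y → ℝ) (x, y) := by
  classical
  -- A `send` node with budget `C = 0` is possible only on an empty rectangle.
  have empty : ∀ (T : CommTree X Y) (C : ℕ) (A : Set X) (B : Set Y),
      (∀ x ∈ A, ∀ y ∈ B, False) →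
      ∃ (ι : Type) (_ : Fintype ι) (R : ι → Set X) (Q : ι → Set Y), Fintype.card ι ≤ 2 ^ C ∧
      ∀ x y, ∑ i, (R i).indicator (1 : X → ℝ) x * (Q i).indicator (1 : Y → ℝ) y =
        {p : X × Y | p.1 ∈ A ∧ p.2 ∈ B ∧ T.run p.1 p.2 = true}.indicator
          (1 : X × Y → ℝ) (x, y) := by
    intro T C A B h
    refine ⟨Empty, inferInstance, Empty.elim, Empty.elim, by simp, fun x y => ?_⟩
    rw [Set.indicator_of_notMem]
    · simp
    · rintro ⟨h1, h2, _⟩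
      exact h x h1 y h2
  induction T with
  | aliceOut f =>
    intro C A B _
    refine ⟨Unit, inferInstance, fun _ => {x | x ∈ A ∧ f x = true}, fun _ => B,
      by simpa using Nat.one_le_two_pow, fun x y => ?_⟩
    by_cases hx : x ∈ A <;> by_cases hy : y ∈ B <;> cases hf : f x <;> simp [run, hx, hy, hf]
  | bobOut g =>
    intro C A B _
    refine ⟨Unit, inferInstance, fun _ => A, fun _ => {y | y ∈ B ∧ g y = true},
      by simpa using Nat.one_le_two_pow, fun x y => ?_⟩
    by_cases hx : x ∈ A <;> by_cases hy : y ∈ B <;> cases hg : g y <;> simp [run, hx, hy, hg]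
  | aliceSend f next ih =>
    intro C A B h
    cases C with
    | zero => exact empty _ _ A B fun x hx y hy => by simpa [bitsSent] using h x hx y hy
    | succ C =>
      have hb : ∀ b, ∀ x ∈ {x | x ∈ A ∧ f x = b}, ∀ y ∈ B, (next b).bitsSent x y ≤ C := by
        rintro b x ⟨hx, rfl⟩ y hy
        simpa [bitsSent] using h x hx y hy
      obtain ⟨ι₁, _, R₁, Q₁, hc₁, h₁⟩ := ih true C _ _ (hb true)
      obtain ⟨ι₂, _, R₂, Q₂, hc₂, h₂⟩ := ih false C _ _ (hb false)
      refine ⟨ι₁ ⊕ ι₂, inferInstance, Sum.elim R₁ R₂, Sum.elim Q₁ Q₂, ?_, fun x y => ?_⟩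
      · rw [Fintype.card_sum, pow_succ]; omega
      · rw [Fintype.sum_sum_type]
        simp only [Sum.elim_inl, Sum.elim_inr]
        rw [h₁, h₂]
        cases hf : f x <;> simp [Set.indicator_apply, run, hf]
  | bobSend g next ih =>
    intro C A B h
    cases C with
    | zero => exact empty _ _ A B fun x hx y hy => by simpa [bitsSent] using h x hx y hy
    | succ C =>
      have hb : ∀ b, ∀ x ∈ A, ∀ y ∈ {y | y ∈ B ∧ g y = b}, (next b).bitsSent x y ≤ C := by
        rintro b x hx y ⟨hy, rfl⟩
        simpa [bitsSent] using h x hx y hy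
      obtain ⟨ι₁, _, R₁, Q₁, hc₁, h₁⟩ := ih true C _ _ (hb true)
      obtain ⟨ι₂, _, R₂, Q₂, hc₂, h₂⟩ := ih false C _ _ (hb false)
      refine ⟨ι₁ ⊕ ι₂, inferInstance, Sum.elim R₁ R₂, Sum.elim Q₁ Q₂, ?_, fun x y => ?_⟩
      · rw [Fintype.card_sum, pow_succ]; omega
      · rw [Fintype.sum_sum_type]
        simp only [Sum.elim_inl, Sum.elim_inr]
        rw [h₁, h₂]
        cases hg : g y <;> simp [Set.indicator_apply, run, hg]

/-- Without communication the output depends on the input of one player only. -/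
theorem run_add_run_of_bitsSent_eq_zero (T : CommTree X Y) (h : ∀ x y, T.bitsSent x y = 0)
    (x x' : X) (y y' : Y) :
    ((T.run x y).toNat : ℝ) + (T.run x' y').toNat = (T.run x y').toNat + (T.run x' y).toNat := by
  cases T with
  | aliceOut f => rfl
  | bobOut g => exact add_comm _ _
  | aliceSend f next => exact absurd (h x y) (by simp [bitsSent])
  | bobSend g next => exact absurd (h x y) (by simp [bitsSent])

end CommTree

/-! ### From rectangles to acceptance probabilities of walks -/

/-- Weighted AM-GM for `a ^ (k + 2) ≤ b ^ k * c`, scaled by `θ ^ (k + 2) = q ^ k * m`. -/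
theorem le_of_pow_le_pow_mul {a b c q m θ : ℝ} {k : ℕ} (hb : 0 ≤ b) (hc : 0 ≤ c)
    (hq : 0 < q) (hm : 0 < m) (hθ : 0 < θ) (hθe : θ ^ (k + 2) = q ^ k * m)
    (h : a ^ (k + 2) ≤ b ^ k * c) :
    (k + 2) * a ≤ θ * (k * (b / q) + c + 1 / m) := by
  have hk : (0 : ℝ) < k + 2 := by positivity
  have amgm := Real.geom_mean_le_arith_mean3_weighted (w₁ := k / (k + 2)) (w₂ := 1 / (k + 2))
    (w₃ := 1 / (k + 2)) (p₁ := b / q) (p₂ := c) (p₃ := 1 / m) (by positivity) (by positivity)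
    (by positivity) (by positivity) hc (by positivity) (by field_simp; ring)
  have e1 : a / θ ≤ (b / q) ^ ((k : ℝ) / (k + 2)) * c ^ (1 / ((k : ℝ) + 2)) *
      (1 / m) ^ (1 / ((k : ℝ) + 2)) := by
    refine le_of_pow_le_pow_left₀ (n := k + 2) (by omega) (by positivity) ?_
    rw [mul_pow, mul_pow, ← Real.rpow_mul_natCast (by positivity), ← Real.rpow_mul_natCast hc,
      ← Real.rpow_mul_natCast (by positivity)]
    push_cast
    rw [div_mul_cancel₀ _ hk.ne', div_mul_cancel₀ _ hk.ne', Real.rpow_natCast, Real.rpow_one,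
      Real.rpow_one, div_pow, div_pow, hθe]
    calc a ^ (k + 2) / (q ^ k * m) ≤ (b ^ k * c) / (q ^ k * m) := by gcongr
      _ = _ := by field_simp
  have e2 := e1.trans amgm
  rw [div_le_iff₀ hθ] at e2
  calc (k + 2) * a ≤ (k + 2) * ((↑k / (↑k + 2) * (b / q) + 1 / (↑k + 2) * c +
        1 / (↑k + 2) * (1 / m)) * θ) := by gcongr
    _ = _ := by field_simp

/-- Disjoint rectangles have total area at most that of the whole square. -/
theorem sum_indicator_le_card {V : Type*} [Fintype V] {ι : Type} [Fintype ι] (R Q : ι → V → ℝ)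
    (h : ∀ x y, ∑ i, R i x * Q i y ≤ 1) :
    ∑ i, (∑ x, R i x) * (∑ y, Q i y) ≤ (Fintype.card V : ℝ) ^ 2 := by
  calc ∑ i, (∑ x, R i x) * (∑ y, Q i y) = ∑ x, ∑ y, ∑ i, R i x * Q i y := by
        simp_rw [Finset.sum_mul_sum]
        rw [Finset.sum_comm]
        refine Finset.sum_congr rfl fun x _ => ?_
        rw [Finset.sum_comm]
    _ ≤ ∑ x : V, ∑ y : V, (1 : ℝ) := by gcongr; exact h _ _
    _ = _ := by simp [sq]

open Matrix in
/-- Comparison of the acceptance probabilities of a deterministic protocol at the ends of walks of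
`k` and of `k + 2` steps. -/
theorem CommTree.walk_bound {X Y V : Type} [Fintype V] [DecidableEq V] [Nonempty V]
    (T : CommTree X Y) (C : ℕ) (hT : ∀ x y, T.bitsSent x y ≤ C) (φ : V → X) (ψ : V → Y)
    (S : Matrix V V ℝ) (hS : S.IsSymm) (h0 : ∀ x y, 0 ≤ S x y) (k : ℕ) (hk : 0 < k)
    {q θ : ℝ} (hq : 0 < q) (hθ : 0 < θ) (hθe : θ ^ (k + 2) = q ^ k * 2 ^ C) :
    (k + 2) * ((∑ x, ∑ y, (S ^ k) x y * ((T.run (φ x) (ψ y)).toNat : ℝ)) / Fintype.card V) ≤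
      θ * (k * (((∑ x, ∑ y, (S ^ (k + 2)) x y * ((T.run (φ x) (ψ y)).toNat : ℝ)) /
        Fintype.card V) / q) + 2) := by
  obtain ⟨ι, _, R, Q, hcard, hRQ⟩ := T.exists_rectangles C Set.univ Set.univ
    fun x _ y _ => hT x y
  set N : ℝ := (Fintype.card V : ℝ) with hN
  have hNpos : 0 < N := by rw [hN]; exact_mod_cast Fintype.card_pos
  set u : ι → V → ℝ := fun i x => (R i).indicator 1 (φ x) with hu
  set v : ι → V → ℝ := fun i y => (Q i).indicator 1 (ψ y) with hv
  have hrun : ∀ x y, ((T.run (φ x) (ψ y)).toNat : ℝ) = ∑ i, u i x * v i y := by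
    intro x y
    rw [hu, hv]
    dsimp only
    rw [hRQ]
    cases h : T.run (φ x) (ψ y) <;> simp [h]
  have hu0 : ∀ i, 0 ≤ u i := fun i x => Set.indicator_nonneg (by simp) _
  have hv0 : ∀ i, 0 ≤ v i := fun i x => Set.indicator_nonneg (by simp) _
  have huu : ∀ i, u i ⬝ᵥ u i = ∑ x, u i x := fun i => Finset.sum_congr rfl fun x _ => by
    by_cases h : φ x ∈ R i <;> simp [hu, h]
  have hvv : ∀ i, v i ⬝ᵥ v i = ∑ x, v i x := fun i => Finset.sum_congr rfl fun x _ => by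
    by_cases h : ψ x ∈ Q i <;> simp [hv, h]
  have hsum : ∀ j, (∑ x, ∑ y, (S ^ j) x y * ((T.run (φ x) (ψ y)).toNat : ℝ)) / N =
      ∑ i, (u i ⬝ᵥ S ^ j *ᵥ v i) / N := by
    intro j
    rw [← Finset.sum_div]
    congr 1
    simp only [hrun, dotProduct, mulVec, Finset.mul_sum]
    refine (Finset.sum_congr rfl fun x _ => Finset.sum_comm).trans ?_
    rw [Finset.sum_comm]
    refine Finset.sum_congr rfl fun i _ => Finset.sum_congr rfl fun x _ =>
      Finset.sum_congr rfl fun y _ => ?_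
    ring
  have nn : ∀ j i, 0 ≤ (u i ⬝ᵥ S ^ j *ᵥ v i) / N := fun j i => div_nonneg
    (dotProduct_nonneg_of_nonneg (hu0 i) (pow_mulVec_nonneg S h0 _ (hv0 i) j)) hNpos.le
  have hc0 : ∀ i, 0 ≤ (∑ x, u i x) * (∑ x, v i x) / N ^ 2 := fun i => div_nonneg
    (mul_nonneg (Finset.sum_nonneg fun x _ => hu0 i x) (Finset.sum_nonneg fun x _ => hv0 i x))
    (by positivity)
  -- A linearised Hölder inequality: the areas and the terms `1 / 2 ^ C` each sum to at most `1`
  -- over the rectangles, which produces the final `2`.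
  have each : ∀ i, (k + 2) * ((u i ⬝ᵥ S ^ k *ᵥ v i) / N) ≤
      θ * (k * ((u i ⬝ᵥ S ^ (k + 2) *ᵥ v i) / N / q) +
        (∑ x, u i x) * (∑ x, v i x) / N ^ 2 + 1 / 2 ^ C) := by
    intro i
    refine le_of_pow_le_pow_mul (nn _ _) (hc0 i) hq (by positivity) hθ hθe ?_
    have := blakley_dixon S hS h0 (u i) (v i) (hu0 i) (hv0 i) k hk
    rw [huu, hvv] at this
    rw [div_pow, div_pow, div_mul_div_comm, pow_add N]
    gcongr
  rw [hsum, hsum]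
  calc _ = ∑ i, (k + 2) * ((u i ⬝ᵥ S ^ k *ᵥ v i) / N) := by rw [Finset.mul_sum]
    _ ≤ ∑ i, θ * (k * ((u i ⬝ᵥ S ^ (k + 2) *ᵥ v i) / N / q) +
        (∑ x, u i x) * (∑ x, v i x) / N ^ 2 + 1 / 2 ^ C) := Finset.sum_le_sum fun i _ => each i
    _ = θ * (k * ((∑ i, (u i ⬝ᵥ S ^ (k + 2) *ᵥ v i) / N) / q) +
        (∑ i, (∑ x, u i x) * (∑ x, v i x)) / N ^ 2 + Fintype.card ι / 2 ^ C) := by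
      rw [← Finset.mul_sum, Finset.sum_add_distrib, Finset.sum_add_distrib, ← Finset.mul_sum,
        Finset.sum_div, Finset.sum_div]
      simp [div_eq_mul_inv]
    _ ≤ _ := by
      have h1 : (∑ i, (∑ x, u i x) * (∑ x, v i x)) / N ^ 2 ≤ 1 := by
        rw [div_le_one (by positivity)]
        refine sum_indicator_le_card u v fun x y => ?_
        rw [← hrun]
        cases T.run (φ x) (ψ y) <;> simp
      have h2 : (Fintype.card ι : ℝ) / 2 ^ C ≤ 1 := by
        rw [div_le_one (by positivity)]
        exact_mod_cast hcard
      exact mul_le_mul_of_nonneg_left (by linarith) hθ.le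

namespace RandProtocol

variable {X Y : Type}

/-- The probability that the protocol outputs `1` on input `(x, y)`. -/
noncomputable def acceptProb (P : RandProtocol X Y) (x : X) (y : Y) : ℝ :=
  @Measure.real P.Ω P.mΩ P.μ {ω | (P.tree ω).run x y = true}

theorem bitsSent_le_of_cost_le (P : RandProtocol X Y) {C : ℕ} (h : P.cost ≤ C) (ω : P.Ω) (x : X)
    (y : Y) : (P.tree ω).bitsSent x y ≤ C := by
  have h1 : ((P.tree ω).bitsSent x y : ℕ∞) ≤ P.cost :=
    le_iSup_of_le ω (le_iSup_of_le x (le_iSup_of_le y le_rfl))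
  exact_mod_cast h1.trans h

theorem acceptProb_eq_integral (P : RandProtocol X Y) (x : X) (y : Y) :
    letI := P.mΩ
    Integrable (fun ω => (((P.tree ω).run x y).toNat : ℝ)) P.μ ∧
    ∫ ω, (((P.tree ω).run x y).toNat : ℝ) ∂P.μ = P.acceptProb x y := by
  let := P.mΩ
  have := P.isProb
  have e : (fun ω => (((P.tree ω).run x y).toNat : ℝ)) =
      {ω | (P.tree ω).run x y = true}.indicator 1 := by
    funext ω
    cases h : (P.tree ω).run x y <;> simp [h]
  rw [e]
  refine ⟨(integrable_const (1 : ℝ)).indicator (P.measurableSet_run x y), ?_⟩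
  exact integral_indicator_one (P.measurableSet_run x y)

theorem acceptProb_nonneg (P : RandProtocol X Y) (x : X) (y : Y) : 0 ≤ P.acceptProb x y :=
  measureReal_nonneg

theorem acceptProb_le_one (P : RandProtocol X Y) (x : X) (y : Y) : P.acceptProb x y ≤ 1 := by
  let := P.mΩ
  have := P.isProb
  exact measureReal_le_one

theorem acceptProb_eq_errorProb (P : RandProtocol X Y) (f : X → Y → Bool) (x : X) (y : Y)
    (h : f x y = false) : P.acceptProb x y = P.errorProb f x y := by
  simp [acceptProb, errorProb, h]

theorem acceptProb_eq_one_sub_errorProb (P : RandProtocol X Y) (f : X → Y → Bool) (x : X) (y : Y)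
    (h : f x y = true) : P.acceptProb x y = 1 - P.errorProb f x y := by
  let := P.mΩ
  have := P.isProb
  have := probReal_compl_eq_one_sub (μ := P.μ) (P.measurableSet_run x y)
  unfold acceptProb errorProb
  rw [h]
  change _ = 1 - P.μ.real {ω | (P.tree ω).run x y = true}ᶜ
  rw [this]
  ring

open Matrix in
/-- Comparison of the acceptance probabilities of a randomized protocol at the ends of walks of
`k` and of `k + 2` steps. -/
theorem walk_bound {V : Type} [Fintype V] [DecidableEq V] [Nonempty V] (P : RandProtocol X Y)
    {C : ℕ} (hC : P.cost ≤ C) (φ : V → X) (ψ : V → Y) (S : Matrix V V ℝ) (hS : S.IsSymm)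
    (h0 : ∀ x y, 0 ≤ S x y) (k : ℕ) (hk : 0 < k) {p q : ℝ} (hp : 0 ≤ p) (hq : 0 < q)
    (hP : p ≤ (∑ x, ∑ y, (S ^ k) x y * P.acceptProb (φ x) (ψ y)) / Fintype.card V)
    (hQ : (∑ x, ∑ y, (S ^ (k + 2)) x y * P.acceptProb (φ x) (ψ y)) / Fintype.card V ≤ q) :
    p ^ (k + 2) ≤ q ^ k * 2 ^ C := by
  let := P.mΩ
  have := P.isProb
  have hpos : 0 < q ^ k * 2 ^ C := by positivity
  -- Since `θ` does not depend on `ω`, the deterministic bound is linear in the acceptance sums and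
  -- can be integrated.
  set θ : ℝ := (q ^ k * 2 ^ C) ^ (((k + 2 : ℕ) : ℝ)⁻¹) with hθdef
  have hθ : 0 < θ := Real.rpow_pos_of_pos hpos _
  have hθe : θ ^ (k + 2) = q ^ k * 2 ^ C := Real.rpow_inv_natCast_pow hpos.le (by omega)
  have int : ∀ j, Integrable (fun ω => ∑ x, ∑ y, (S ^ j) x y *
        (((P.tree ω).run (φ x) (ψ y)).toNat : ℝ)) P.μ ∧
      ∫ ω, ∑ x, ∑ y, (S ^ j) x y * (((P.tree ω).run (φ x) (ψ y)).toNat : ℝ) ∂P.μ =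
      ∑ x, ∑ y, (S ^ j) x y * P.acceptProb (φ x) (ψ y) := by
    intro j
    have i1 : ∀ x y, Integrable (fun ω => (S ^ j) x y *
        (((P.tree ω).run (φ x) (ψ y)).toNat : ℝ)) P.μ := fun x y =>
      (P.acceptProb_eq_integral (φ x) (ψ y)).1.const_mul _
    have i2 : ∀ x, Integrable (fun ω => ∑ y, (S ^ j) x y *
        (((P.tree ω).run (φ x) (ψ y)).toNat : ℝ)) P.μ := fun x =>
      integrable_finsetSum _ fun y _ => i1 x y
    refine ⟨integrable_finsetSum _ fun x _ => i2 x, ?_⟩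
    rw [integral_finsetSum _ fun x _ => i2 x]
    refine Finset.sum_congr rfl fun x _ => ?_
    rw [integral_finsetSum _ fun y _ => i1 x y]
    refine Finset.sum_congr rfl fun y _ => ?_
    rw [integral_const_mul, (P.acceptProb_eq_integral (φ x) (ψ y)).2]
  have mono := integral_mono (μ := P.μ)
    (((int k).1.div_const (Fintype.card V : ℝ)).const_mul (k + 2))
    ((((((int (k + 2)).1.div_const (Fintype.card V : ℝ)).div_const q).const_mul (k : ℝ)).add
      (integrable_const 2)).const_mul θ)
    fun ω => (P.tree ω).walk_bound C (P.bitsSent_le_of_cost_le hC ω) φ ψ S hS h0 k hk hq hθ hθe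
  simp only [Pi.add_apply] at mono
  rw [integral_const_mul, integral_div, (int k).2, integral_const_mul,
    integral_add ((((int (k + 2)).1.div_const _).div_const q).const_mul (k : ℝ))
      (integrable_const 2),
    integral_const_mul, integral_div, integral_div, (int (k + 2)).2] at mono
  simp only [integral_const, probReal_univ, smul_eq_mul, one_mul] at mono
  have h1 : ((k : ℝ) + 2) * p ≤ (k + 2) * θ := by
    calc ((k : ℝ) + 2) * p ≤ _ := mul_le_mul_of_nonneg_left hP (by positivity)
      _ ≤ _ := mono
      _ ≤ θ * (k * (q / q) + 2) := by gcongr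
      _ = _ := by rw [div_self hq.ne']; ring
  rw [← hθe]
  exact pow_le_pow_left₀ hp (le_of_mul_le_mul_left h1 (by positivity)) _

/-- A protocol without communication treats the four corners of a rectangle additively. -/
theorem acceptProb_add_acceptProb_of_cost_eq_zero (P : RandProtocol X Y) (h : P.cost ≤ (0 : ℕ))
    (x x' : X) (y y' : Y) :
    P.acceptProb x y + P.acceptProb x' y' = P.acceptProb x y' + P.acceptProb x' y := by
  let := P.mΩ
  have := P.isProb
  have i := fun x y => (P.acceptProb_eq_integral x y).1
  simp only [← fun x y => (P.acceptProb_eq_integral x y).2]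
  rw [← integral_add (i _ _) (i _ _), ← integral_add (i _ _) (i _ _)]
  refine integral_congr_ae (Filter.Eventually.of_forall fun ω => ?_)
  exact (P.tree ω).run_add_run_of_bitsSent_eq_zero
    (fun x y => Nat.le_zero.mp (P.bitsSent_le_of_cost_le h ω x y)) x x' y y'

end RandProtocol

/-! ### Random walk on the cube and the birthday estimate -/

section CubeWalk

open Matrix

variable {ι : Type} [DecidableEq ι]

/-- The point of the cube that differs from `x` exactly in the coordinate `i`. -/
def flipAt (i : ι) (x : ι → Bool) : ι → Bool := Function.update x i (!x i)

theorem flipAt_eq_comm (i : ι) (x y : ι → Bool) : y = flipAt i x ↔ x = flipAt i y := by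
  constructor <;> rintro rfl <;> simp [flipAt]

variable [Fintype ι]

/-- The transition matrix of the random walk on the cube that flips in each step a uniformly
random coordinate of `I`. -/
noncomputable def cubeWalk (I : Finset ι) : Matrix (ι → Bool) (ι → Bool) ℝ :=
  fun x y => (∑ i ∈ I, if y = flipAt i x then 1 else 0) / I.card

theorem cubeWalk_isSymm (I : Finset ι) : (cubeWalk I).IsSymm := by
  ext x y
  simp only [transpose_apply, cubeWalk, flipAt_eq_comm _ x y]

theorem cubeWalk_nonneg (I : Finset ι) (x y : ι → Bool) : 0 ≤ cubeWalk I x y :=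
  div_nonneg (Finset.sum_nonneg fun _ _ => by split_ifs <;> simp) (by positivity)

theorem cubeWalk_mulVec (I : Finset ι) (f : (ι → Bool) → ℝ) (x : ι → Bool) :
    (cubeWalk I *ᵥ f) x = (∑ i ∈ I, f (flipAt i x)) / I.card := by
  simp only [mulVec, dotProduct, cubeWalk, div_mul_eq_mul_div, ← Finset.sum_div, Finset.sum_mul]
  rw [Finset.sum_comm]
  simp

theorem cubeWalk_pow_mulVec_one (I : Finset ι) (hI : I.Nonempty) (k : ℕ) :
    cubeWalk I ^ k *ᵥ 1 = 1 := by
  induction k with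
  | zero => simp
  | succ k ih =>
    rw [pow_succ', ← mulVec_mulVec, ih]
    funext x
    rw [cubeWalk_mulVec]
    simp [hI.card_ne_zero]

/-- The indicator of the points that differ from `x` in exactly `m` coordinates, all in `I`. -/
noncomputable def sphereIndicator (I : Finset ι) (x : ι → Bool) (m : ℕ) (z : ι → Bool) : ℝ :=
  open Classical in if hammingDist x z = m ∧ ∀ i ∉ I, x i = z i then 1 else 0

theorem hammingDist_flipAt {x z : ι → Bool} {i : ι} (h : x i = z i) :
    hammingDist x (flipAt i z) = hammingDist x z + 1 := by
  unfold hammingDist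
  rw [← Finset.card_insert_of_notMem (a := i) (by simp [h])]
  congr 1
  ext j
  simp only [Finset.mem_insert, Finset.mem_filter, Finset.mem_univ, true_and]
  by_cases hj : j = i
  · subst hj; simp [flipAt, h]
  · simp [flipAt, hj]

/-- From distance `m` inside `I`, only the `m` coordinates already flipped fail to increase the
distance, out of `I.card` equally likely ones. -/
theorem cubeWalk_mulVec_sphereIndicator (I : Finset ι) (hI : I.Nonempty) (x : ι → Bool) (m : ℕ)
    (z : ι → Bool) :
    sphereIndicator I x m z - m / I.card ≤ (cubeWalk I *ᵥ sphereIndicator I x (m + 1)) z := by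
  have hc : (0 : ℝ) < I.card := by exact_mod_cast hI.card_pos
  have nn : ∀ w, 0 ≤ sphereIndicator I x (m + 1) w := fun w => by
    unfold sphereIndicator; split_ifs <;> simp
  rw [cubeWalk_mulVec]
  by_cases h : hammingDist x z = m ∧ ∀ i ∉ I, x i = z i
  · have h1 : sphereIndicator I x m z = 1 := if_pos h
    have h2 : ∑ i ∈ I with x i = z i, (1 : ℝ) ≤ ∑ i ∈ I, sphereIndicator I x (m + 1) (flipAt i z) := by
      refine (Finset.sum_le_sum fun i hi => ?_).trans
        (Finset.sum_le_sum_of_subset_of_nonneg (Finset.filter_subset _ _) fun i _ _ => nn _)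
      rw [Finset.mem_filter] at hi
      refine (if_pos ⟨by rw [hammingDist_flipAt hi.2, h.1], fun j hj => ?_⟩).ge
      have : j ≠ i := by rintro rfl; exact hj hi.1
      simp [flipAt, this, h.2 j hj]
    have h3 : (I.filter fun i => x i = z i).card + m = I.card := by
      rw [← h.1, ← Finset.card_filter_add_card_filter_not (s := I) (fun i => x i = z i)]
      congr 1
      unfold hammingDist
      congr 1
      ext j
      simp only [Finset.mem_filter, Finset.mem_univ, true_and, iff_and_self]
      exact fun hj => by_contra fun hjI => hj (h.2 j hjI)
    have h4 : ((I.filter fun i => x i = z i).card : ℝ) + m = I.card := by exact_mod_cast h3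
    rw [Finset.sum_const, nsmul_eq_mul, mul_one] at h2
    rw [h1, le_div_iff₀ hc, sub_mul, div_mul_cancel₀ _ hc.ne']
    linarith
  · have h1 : sphereIndicator I x m z = 0 := if_neg h
    rw [h1]
    have : 0 ≤ (∑ i ∈ I, sphereIndicator I x (m + 1) (flipAt i z)) / (I.card : ℝ) :=
      div_nonneg (Finset.sum_nonneg fun i _ => nn _) hc.le
    have : (0 : ℝ) ≤ m / I.card := by positivity
    linarith

/-- After `k` steps the walk is at distance exactly `k`, except with small probability. -/
theorem one_sub_le_cubeWalk_pow_mulVec (I : Finset ι) (hI : I.Nonempty) (x : ι → Bool) (k : ℕ) :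
    1 - (k * (k - 1) : ℝ) / (2 * I.card) ≤ (cubeWalk I ^ k *ᵥ sphereIndicator I x k) x := by
  have hc : (0 : ℝ) < I.card := by exact_mod_cast hI.card_pos
  induction k with
  | zero => simp [sphereIndicator]
  | succ k ih =>
    -- The power of the walk preserves inequalities and fixes `1`, so step `k` adds a loss of `k /
    -- I.card`; the losses sum to the birthday bound.
    have h := pow_mulVec_nonneg (cubeWalk I) (cubeWalk_nonneg I)
      (cubeWalk I *ᵥ sphereIndicator I x (k + 1) -
        (sphereIndicator I x k - ((k : ℝ) / I.card) • 1))
      (fun z => by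
        have := cubeWalk_mulVec_sphereIndicator I hI x k z
        simp only [Pi.sub_apply, Pi.smul_apply, Pi.one_apply, smul_eq_mul, mul_one, Pi.zero_apply]
        linarith) k x
    rw [mulVec_sub, mulVec_sub, mulVec_smul, cubeWalk_pow_mulVec_one I hI, mulVec_mulVec,
      ← pow_succ] at h
    simp only [Pi.sub_apply, Pi.smul_apply, Pi.one_apply, smul_eq_mul, mul_one,
      Pi.zero_apply] at h
    have e : ((k + 1 : ℕ) * ((k + 1 : ℕ) - 1) : ℝ) / (2 * I.card) =
        (k * (k - 1) : ℝ) / (2 * I.card) + k / I.card := by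
      push_cast
      field_simp
      ring
    rw [e]
    linarith

end CubeWalk

/-! ### Hamming distance protocols evaluated on the walk -/

/-- Negation of the coordinates outside `I`. -/
def negateOutside {n : ℕ} (I : Finset (Fin n)) (z : Fin n → Bool) : Fin n → Bool :=
  fun i => if i ∈ I then z i else !z i

theorem hammingDist_negateOutside {n : ℕ} (I : Finset (Fin n)) {x z : Fin n → Bool}
    (h : ∀ i ∉ I, x i = z i) :
    hammingDist x (negateOutside I z) = hammingDist x z + Iᶜ.card := by
  unfold hammingDist
  rw [← Finset.card_union_of_disjoint]
  · congr 1
    ext i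
    simp only [Finset.mem_union, Finset.mem_compl, Finset.mem_filter, Finset.mem_univ, true_and]
    by_cases hi : i ∈ I
    · simp [negateOutside, hi]
    · simp [negateOutside, hi, h i hi]
  · rw [Finset.disjoint_left]
    intro i hi hI
    simp only [Finset.mem_filter, Finset.mem_univ, true_and] at hi
    exact hi (h i (by simpa using hI))

namespace RandProtocol

variable {n : ℕ}

-- Acceptance is at least `1 - δ` times the indicator of the sphere, and `(1 - δ) * (1 - ε) ≥ 1 - δ
-- - ε`.
open Matrix in
theorem le_average_acceptProb (P : RandProtocol (Fin n → Bool) (Fin n → Bool))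
    (I : Finset (Fin n)) (hI : I.Nonempty) (m : ℕ) {δ ε : ℝ} (hδ : 0 ≤ δ) (hδ1 : δ ≤ 1)
    (hε0 : 0 ≤ ε) (hε : (m * (m - 1) : ℝ) / (2 * I.card) ≤ ε)
    (h : ∀ x y, hammingDist x y = m + Iᶜ.card → 1 - δ ≤ P.acceptProb x y) :
    1 - δ - ε ≤ (∑ x, ∑ z, (cubeWalk I ^ m) x z * P.acceptProb x (negateOutside I z)) /
      Fintype.card (Fin n → Bool) := by
  have hN : (0 : ℝ) < Fintype.card (Fin n → Bool) := by exact_mod_cast Fintype.card_pos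
  rw [le_div_iff₀ hN]
  have each : ∀ x, 1 - δ - ε ≤
      ∑ z, (cubeWalk I ^ m) x z * P.acceptProb x (negateOutside I z) := by
    intro x
    have h1 := pow_mulVec_nonneg (cubeWalk I) (cubeWalk_nonneg I)
      ((fun z => P.acceptProb x (negateOutside I z)) - (1 - δ) • sphereIndicator I x m)
      (fun z => by
        simp only [Pi.sub_apply, Pi.smul_apply, smul_eq_mul, Pi.zero_apply, sphereIndicator]
        split_ifs with hz
        · have := h x (negateOutside I z) (by rw [hammingDist_negateOutside I hz.2, hz.1])
          linarith
        · have := P.acceptProb_nonneg x (negateOutside I z)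
          linarith) m x
    rw [mulVec_sub, mulVec_smul] at h1
    simp only [Pi.sub_apply, Pi.smul_apply, smul_eq_mul, Pi.zero_apply] at h1
    have h2 := one_sub_le_cubeWalk_pow_mulVec I hI x m
    have h3 : (1 - δ) * (1 - ε) ≤ (1 - δ) * (cubeWalk I ^ m *ᵥ sphereIndicator I x m) x :=
      mul_le_mul_of_nonneg_left (by linarith) (by linarith)
    have h4 : 0 ≤ δ * ε := mul_nonneg hδ hε0
    change _ ≤ (cubeWalk I ^ m *ᵥ fun z => P.acceptProb x (negateOutside I z)) x
    linarith
  calc (1 - δ - ε) * Fintype.card (Fin n → Bool) = ∑ _x : Fin n → Bool, (1 - δ - ε) := by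
        rw [Finset.sum_const, nsmul_eq_mul, mul_comm, Finset.card_univ]
    _ ≤ _ := Finset.sum_le_sum fun x _ => each x

-- Acceptance is at most `1 - (1 - δ)` times the indicator of the sphere: off the sphere only the
-- trivial bound `1` is available.
open Matrix in
theorem average_acceptProb_le (P : RandProtocol (Fin n → Bool) (Fin n → Bool))
    (I : Finset (Fin n)) (hI : I.Nonempty) (m : ℕ) {δ ε : ℝ} (hδ : 0 ≤ δ) (hδ1 : δ ≤ 1)
    (hε0 : 0 ≤ ε) (hε : (m * (m - 1) : ℝ) / (2 * I.card) ≤ ε)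
    (h : ∀ x y, hammingDist x y = m + Iᶜ.card → P.acceptProb x y ≤ δ) :
    (∑ x, ∑ z, (cubeWalk I ^ m) x z * P.acceptProb x (negateOutside I z)) /
      Fintype.card (Fin n → Bool) ≤ δ + ε := by
  have hN : (0 : ℝ) < Fintype.card (Fin n → Bool) := by exact_mod_cast Fintype.card_pos
  rw [div_le_iff₀ hN]
  have each : ∀ x, ∑ z, (cubeWalk I ^ m) x z * P.acceptProb x (negateOutside I z) ≤ δ + ε := by
    intro x
    have h1 := pow_mulVec_nonneg (cubeWalk I) (cubeWalk_nonneg I)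
      (1 - (1 - δ) • sphereIndicator I x m - (fun z => P.acceptProb x (negateOutside I z)))
      (fun z => by
        simp only [Pi.sub_apply, Pi.smul_apply, smul_eq_mul, Pi.zero_apply, sphereIndicator,
          Pi.one_apply]
        split_ifs with hz
        · have := h x (negateOutside I z) (by rw [hammingDist_negateOutside I hz.2, hz.1])
          linarith
        · have := P.acceptProb_le_one x (negateOutside I z)
          linarith) m x
    rw [mulVec_sub, mulVec_sub, mulVec_smul, cubeWalk_pow_mulVec_one I hI] at h1
    simp only [Pi.sub_apply, Pi.smul_apply, smul_eq_mul, Pi.zero_apply, Pi.one_apply] at h1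
    have h2 := one_sub_le_cubeWalk_pow_mulVec I hI x m
    have h3 : (1 - δ) * (1 - ε) ≤ (1 - δ) * (cubeWalk I ^ m *ᵥ sphereIndicator I x m) x :=
      mul_le_mul_of_nonneg_left (by linarith) (by linarith)
    have h4 : 0 ≤ δ * ε := mul_nonneg hδ hε0
    change (cubeWalk I ^ m *ᵥ fun z => P.acceptProb x (negateOutside I z)) x ≤ _
    linarith
  calc _ ≤ ∑ _x : Fin n → Bool, (δ + ε) := Finset.sum_le_sum fun x _ => each x
    _ = (δ + ε) * Fintype.card (Fin n → Bool) := by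
        rw [Finset.sum_const, nsmul_eq_mul, mul_comm, Finset.card_univ]

theorem acceptProb_of_hamPromise {k : ℕ} {δ : ℝ}
    (P : RandProtocol (Fin n → Bool) (Fin n → Bool))
    (herr : ∀ x y, (x, y) ∈ hamPromise n k → P.errorProb (hamProblem n k) x y ≤ δ) :
    (∀ x y, hammingDist x y = k → 1 - δ ≤ P.acceptProb x y) ∧
    (∀ x y, hammingDist x y = k + 2 → P.acceptProb x y ≤ δ) := by
  constructor
  · intro x y h
    rw [P.acceptProb_eq_one_sub_errorProb (hamProblem n k) x y (by simp [hamProblem, h])]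
    have := herr x y (Or.inl h)
    linarith
  · intro x y h
    rw [P.acceptProb_eq_errorProb (hamProblem n k) x y (by simp [hamProblem, h])]
    exact herr x y (Or.inr h)

/-- The main inequality between error and cost: only `m` of the `k` differences are produced by
a random walk, which flips `d = n - (k - m)` coordinates. -/
theorem hamming_bound {k : ℕ} {δ ε : ℝ} (P : RandProtocol (Fin n → Bool) (Fin n → Bool)) {C : ℕ}
    (hC : P.cost ≤ C)
    (herr : ∀ x y, (x, y) ∈ hamPromise n k → P.errorProb (hamProblem n k) x y ≤ δ)
    (m : ℕ) (hm : 0 < m) (hmk : m ≤ k) (hkn : k ≤ n) (hδ : 0 < δ) (hε : 0 ≤ ε)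
    (hδε : δ + ε ≤ 1)
    (hd : ((m + 2) * (m + 1) : ℝ) / (2 * (n - (k - m))) ≤ ε) :
    (1 - δ - ε) ^ (m + 2) ≤ (δ + ε) ^ m * 2 ^ C := by
  -- The complement of `I` has `k - m` elements, so walks of `m` and `m + 2` steps lead to distances
  -- `k` and `k + 2` after the negation.
  obtain ⟨I, -, hIc⟩ := Finset.exists_subset_card_eq
    (s := (Finset.univ : Finset (Fin n))) (n := n - (k - m)) (by simp)
  have hIpos : I.Nonempty := Finset.card_pos.mp (by omega)
  have hcompl : Iᶜ.card = k - m := by rw [Finset.card_compl, hIc, Fintype.card_fin]; omega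
  have hIr : (I.card : ℝ) = n - (k - m) := by
    rw [hIc, Nat.cast_sub (by omega), Nat.cast_sub hmk]
  have hIr0 : (0 : ℝ) < I.card := by exact_mod_cast hIpos.card_pos
  obtain ⟨h1, h2⟩ := P.acceptProb_of_hamPromise herr
  rw [← hIr] at hd
  refine P.walk_bound hC id (negateOutside I) (cubeWalk I) (cubeWalk_isSymm I) (cubeWalk_nonneg I)
    m hm (by linarith) (by linarith)
    (P.le_average_acceptProb I hIpos m hδ.le (by linarith) hε (le_trans ?_ hd)
      fun x y h => h1 x y (by rw [h, hcompl]; omega))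
    (P.average_acceptProb_le I hIpos (m + 2) hδ.le (by linarith) hε (le_trans (le_of_eq ?_) hd)
      fun x y h => h2 x y (by rw [h, hcompl]; omega))
  · have : (0 : ℝ) ≤ m := by positivity
    exact div_le_div_of_nonneg_right (by nlinarith) (by positivity)
  · push_cast; ring

/-- Some communication is needed. -/
theorem one_le_of_cost_le {k : ℕ} {δ : ℝ} (P : RandProtocol (Fin n → Bool) (Fin n → Bool))
    {C : ℕ} (hC : P.cost ≤ C)
    (herr : ∀ x y, (x, y) ∈ hamPromise n k → P.errorProb (hamProblem n k) x y ≤ δ)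
    (hδ : δ < 1 / 2) (hk : 0 < k) (hkn : k + 2 ≤ n) : 1 ≤ C := by
  by_contra hC0
  obtain rfl : C = 0 := by omega
  obtain ⟨h1, h2⟩ := P.acceptProb_of_hamPromise herr
  have count : ∀ (x y : Fin n → Bool) (a b : ℕ), a ≤ b → b ≤ n →
      (∀ i, x i ≠ y i ↔ a ≤ (i : ℕ) ∧ (i : ℕ) < b) → hammingDist x y = b - a := by
    intro x y a b hab hbn h
    unfold hammingDist
    simp only [h]
    rw [← Nat.card_Ico, ← Finset.card_map Fin.valEmbedding]
    congr 1
    ext j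
    simp only [Finset.mem_map, Finset.mem_filter, Finset.mem_univ, true_and, Finset.mem_Ico,
      Fin.valEmbedding_apply]
    exact ⟨by rintro ⟨i, hi, rfl⟩; exact hi, fun hj => ⟨⟨j, by omega⟩, hj, rfl⟩⟩
  -- The pairs `(x, y)`, `(x', y')` have distance `k` and the crossed pairs `k + 2`. Additivity over
  -- the four corners would give `2 * (1 - δ) ≤ 2 * δ`.
  let x : Fin n → Bool := fun _ => false
  let y : Fin n → Bool := fun i => decide ((i : ℕ) < k)
  let y' : Fin n → Bool := fun i => decide ((i : ℕ) < k + 2)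
  let x' : Fin n → Bool := fun i => decide (k ≤ (i : ℕ) ∧ (i : ℕ) < k + 2)
  have d1 : hammingDist x y = k := by
    rw [count x y 0 k (by omega) (by omega) fun i => by simp [x, y]]; omega
  have d2 : hammingDist x y' = k + 2 := by
    rw [count x y' 0 (k + 2) (by omega) (by omega) fun i => by simp [x, y']]; omega
  have d3 : hammingDist x' y' = k := by
    rw [count x' y' 0 k (by omega) (by omega) fun i => by simp only [x', y', ne_eq, decide_eq_decide]; omega]; omega
  have d4 : hammingDist x' y = k + 2 := by
    rw [count x' y 0 (k + 2) (by omega) (by omega) fun i => by simp only [x', y, ne_eq, decide_eq_decide]; omega]; omega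
  have := P.acceptProb_add_acceptProb_of_cost_eq_zero hC x x' y y'
  have := h1 x y d1
  have := h1 x' y' d3
  have := h2 x y' d2
  have := h2 x' y d4
  linarith

end RandProtocol

/-! ### Small error, constant error, and the conclusion -/

theorem ofReal_le_randCCOn {X Y : Type} {D : Set (X × Y)} {δ v : ℝ} {f : X → Y → Bool}
    (h : ∀ P : RandProtocol X Y, (∀ x y, (x, y) ∈ D → P.errorProb f x y ≤ δ) →
      ∀ C : ℕ, P.cost ≤ C → v ≤ C) :
    ENNReal.ofReal v ≤ (randCCOn D δ f : ENNReal) := by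
  have h1 : ((⌈v⌉₊ : ℕ) : ℕ∞) ≤ randCCOn D δ f := by
    refine le_iInf₂ fun P hP => ?_
    rcases eq_or_ne P.cost ⊤ with hc | hc
    · rw [hc]; exact le_top
    · obtain ⟨C, hC⟩ := ENat.ne_top_iff_exists.mp hc
      rw [← hC, Nat.cast_le]
      exact Nat.ceil_le.mpr (h P hP C hC.ge)
  calc ENNReal.ofReal v ≤ ENNReal.ofReal (⌈v⌉₊ : ℕ) := ENNReal.ofReal_le_ofReal (Nat.le_ceil v)
    _ = (((⌈v⌉₊ : ℕ) : ℕ∞) : ENNReal) := by simp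
    _ ≤ _ := ENat.toENNReal_mono h1

theorem randCCOn_mono {X Y : Type} {D D' : Set (X × Y)} (h : D ⊆ D') (δ : ℝ) (f : X → Y → Bool) :
    randCCOn D δ f ≤ randCCOn D' δ f :=
  le_iInf₂ fun P hP => iInf₂_le P fun x y hxy => hP x y (h hxy)

namespace RandProtocol

variable {n k : ℕ} {δ : ℝ} (P : RandProtocol (Fin n → Bool) (Fin n → Bool)) {C : ℕ}

theorem cost_ge_of_small_error (hC : P.cost ≤ C)
    (herr : ∀ x y, (x, y) ∈ hamPromise n k → P.errorProb (hamProblem n k) x y ≤ δ)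
    (hk : 0 < k) (hδ : 0 < δ) (hδ1 : δ ≤ 1 / 1024) (hkn : (k : ℝ) ^ 2 ≤ δ * n) :
    1 / 2 * (k * Real.log (1 / δ)) ≤ C := by
  have hk1 : (1 : ℝ) ≤ k := by exact_mod_cast hk
  have hn : (k : ℝ) ≤ n := by nlinarith
  -- The whole distance comes from the walk (`m = k`). For `k ≥ 1`, `(k + 2) * (k + 1) ≤ 6 * k ^ 2`,
  -- so the collision probability is at most `3 * δ`.
  have hb := P.hamming_bound (ε := 3 * δ) hC herr k hk le_rfl (by exact_mod_cast hn) hδ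
    (by linarith) (by linarith) (by
      rw [sub_self, sub_zero, div_le_iff₀ (by linarith)]
      nlinarith)
  have e : (1 / 2 : ℝ) ^ (k + 2) ≤ (4 * δ) ^ k * 2 ^ C := by
    refine le_trans (pow_le_pow_left₀ (by norm_num) (by linarith) _) (hb.trans_eq ?_)
    ring
  have hl := Real.log_le_log (by positivity) e
  rw [Real.log_pow, Real.log_mul (by positivity) (by positivity), Real.log_pow, Real.log_pow,
    Real.log_mul (by norm_num) hδ.ne', one_div, Real.log_inv,
    show (4 : ℝ) = 2 ^ 2 by norm_num, Real.log_pow] at hl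
  push_cast at hl
  -- The loss in `hl` is `(3 * k + 2) * log 2 ≤ 5 * k * log 2`; the threshold `1 / 1024` makes it at
  -- most half of `k * log (1 / δ)`.
  have h2 : Real.log δ ≤ -(10 * Real.log 2) := by
    have := Real.log_le_log hδ hδ1
    rw [one_div, Real.log_inv, show (1024 : ℝ) = 2 ^ 10 by norm_num, Real.log_pow] at this
    exact_mod_cast this
  have hlog2 : Real.log 2 ≤ 1 := by linarith [Real.log_two_lt_d9]
  have hlog2' : 0 < Real.log 2 := Real.log_pos (by norm_num)
  rw [one_div δ, Real.log_inv]
  have h3 : (C : ℝ) * Real.log 2 ≤ C := by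
    have : (0 : ℝ) ≤ C := by positivity
    nlinarith
  nlinarith

theorem cost_ge_mul_of_error_lt_half {δ₀ : ℝ} (h0 : 0 < δ₀) (hδ₀ : δ₀ < 1 / 2) :
    ∃ c : ℝ, 0 < c ∧ ∀ (n k : ℕ) (δ : ℝ) (P : RandProtocol (Fin n → Bool) (Fin n → Bool)) (C : ℕ),
      0 < k → 0 < δ → δ ≤ δ₀ → (k : ℝ) ^ 2 ≤ δ * n → P.cost ≤ C →
      (∀ x y, (x, y) ∈ hamPromise n k → P.errorProb (hamProblem n k) x y ≤ δ) → c * k ≤ C := by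
  -- With collision probability at most `γ`, the two acceptance bounds remain separated: `δ + γ ≤ 1
  -- / 2 - γ` and `1 - δ - γ ≥ 1 / 2 + γ`. The choice `M ≥ 3 / γ` makes walks of about `k / M` steps
  -- short enough.
  obtain ⟨γ, hγ⟩ : ∃ γ, γ = (1 / 2 - δ₀) / 2 := ⟨_, rfl⟩
  have hγ0 : 0 < γ := by linarith
  have hq : 0 < 1 / 2 - γ := by linarith
  obtain ⟨M, hM⟩ := exists_nat_ge (3 / γ)
  rw [div_le_iff₀ hγ0] at hM
  have hM0 : 0 < M := by
    rcases Nat.eq_zero_or_pos M with h | h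
    · rw [h] at hM; norm_num at hM
    · exact h
  have hM1 : (1 : ℝ) ≤ M := by exact_mod_cast hM0
  set L := Real.log (1 / 2 + γ) - Real.log (1 / 2 - γ) with hL
  have hL0 : 0 < L := sub_pos.mpr (Real.log_lt_log hq (by linarith))
  refine ⟨min (1 / M) (L / (6 * M)), lt_min (by positivity) (by positivity), ?_⟩
  intro n k δ P C hk hδ hδδ hkn hC herr
  have hk1 : (1 : ℝ) ≤ k := by exact_mod_cast hk
  have hn0 : (0 : ℝ) < n := by
    by_contra h
    have : (n : ℝ) = 0 := le_antisymm (not_lt.mp h) (by positivity)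
    rw [this] at hkn
    nlinarith
  have hn : 2 * (k : ℝ) ^ 2 < n := by nlinarith
  have hn' : 2 * k ^ 2 < n := by exact_mod_cast hn
  have hC1 : 1 ≤ C := P.one_le_of_cost_le hC herr (by linarith) hk (by nlinarith)
  have hC1' : (1 : ℝ) ≤ C := by exact_mod_cast hC1
  have hdiv := Nat.div_add_mod k M
  have hmod := Nat.mod_lt k hM0
  obtain ⟨m, hm⟩ : ∃ m, m = k / M := ⟨_, rfl⟩
  rw [← hm] at hdiv
  -- If `m = 0` then `k < M`, and one bit of communication is enough for the bound.
  rcases Nat.eq_zero_or_pos m with hm0 | hm0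
  · rw [hm0] at hdiv
    have hkM : (k : ℝ) ≤ M := by exact_mod_cast (by omega : k ≤ M)
    calc min (1 / (M : ℝ)) (L / (6 * M)) * k ≤ 1 / M * k := by
          gcongr; exact min_le_left _ _
      _ ≤ 1 := by rw [one_div, inv_mul_le_one₀ (by linarith)]; exact hkM
      _ ≤ C := hC1'
  · have hm1 : (1 : ℝ) ≤ m := by exact_mod_cast hm0
    have hMm : (M : ℝ) * m ≤ k := by exact_mod_cast (by omega : M * m ≤ k)
    have hk2 : (k : ℝ) ≤ 2 * M * m := by
      have : k ≤ M * m + M := by omega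
      have : (k : ℝ) ≤ M * m + M := by exact_mod_cast this
      nlinarith
    have hmk : m ≤ k := hm ▸ Nat.div_le_self k M
    have hmk' : (m : ℝ) ≤ k := by exact_mod_cast hmk
    have hkn' : k ≤ n := by nlinarith
    have hd : (n : ℝ) ≤ 2 * (n - (k - m)) := by nlinarith
    have hb := P.hamming_bound (ε := γ) hC herr m hm0 hmk hkn' hδ hγ0.le (by linarith) (by
      rw [div_le_iff₀ (by linarith)]
      have h1 : ((m : ℝ) + 2) * (m + 1) ≤ 6 * m ^ 2 := by nlinarith
      have h2 : (M : ℝ) ^ 2 * m ^ 2 ≤ k ^ 2 := by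
        rw [← mul_pow]; exact pow_le_pow_left₀ (by positivity) hMm 2
      have h3 : 3 * (m : ℝ) ^ 2 ≤ γ * k ^ 2 := by
        calc 3 * (m : ℝ) ^ 2 ≤ (M * γ) * m ^ 2 := by gcongr
          _ ≤ (M * γ * M) * m ^ 2 := by
            exact mul_le_mul_of_nonneg_right (le_mul_of_one_le_right (by positivity) hM1)
              (by positivity)
          _ = γ * (M ^ 2 * m ^ 2) := by ring
          _ ≤ _ := by gcongr
      have h4 : γ * (2 * (k : ℝ) ^ 2) ≤ γ * n := by gcongr
      have h5 : γ * (n : ℝ) ≤ γ * (2 * (n - (k - m))) := by gcongr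
      linarith)
    have e : (1 / 2 + γ) ^ (m + 2) ≤ (1 / 2 - γ) ^ m * 2 ^ C := by
      refine le_trans (pow_le_pow_left₀ (by linarith) (by linarith) _) (hb.trans ?_)
      gcongr
      linarith
    have hl := Real.log_le_log (by positivity) e
    rw [Real.log_pow, Real.log_mul (by positivity) (by positivity), Real.log_pow,
      Real.log_pow] at hl
    push_cast at hl
    have hp : -Real.log 2 ≤ Real.log (1 / 2 + γ) := by
      rw [← Real.log_inv]
      exact Real.log_le_log (by norm_num) (by norm_num; linarith)
    have hlog2 : Real.log 2 ≤ 1 := by linarith [Real.log_two_lt_d9]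
    -- The two surplus factors in the exponent `m + 2` cost at most `2 * log 2 ≤ 2 * C`, because `C
    -- ≥ 1`.
    have h1 : m * L ≤ 3 * C := by
      rw [hL]
      nlinarith
    calc min (1 / (M : ℝ)) (L / (6 * M)) * k ≤ L / (6 * M) * (2 * M * m) := by
          gcongr; exact min_le_right _ _
      _ = m * L / 3 := by field_simp; norm_num
      _ ≤ C := by linarith

end RandProtocol

theorem theorem4 (δ₀ : ℝ) (hδ₀ : δ₀ < 1 / 2) :
    ∃ c : ℝ, 0 < c ∧
      ∀ (n k : ℕ) (δ : ℝ), 0 < δ → δ ≤ δ₀ → (k : ℝ) ^ 2 ≤ δ * n →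
        ENNReal.ofReal (c * (k * Real.log (1 / δ))) ≤ (randCC δ (hamProblem n k) : ENNReal) ∧
        ENNReal.ofReal (c * (k * Real.log (1 / δ))) ≤
          (randCCOn (hamPromise n k) δ (hamProblem n k) : ENNReal) := by
  rcases le_or_gt δ₀ 0 with h0 | h0
  · exact ⟨1, one_pos, fun n k δ h1 h2 => absurd (h1.trans_le h2) (not_lt.mpr h0)⟩
  obtain ⟨c, hc, hbound⟩ := RandProtocol.cost_ge_mul_of_error_lt_half h0 hδ₀
  -- The factor `1 / 10` pays for `log (1 / δ) ≤ 10` when `δ > 1 / 1024`.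
  refine ⟨min (1 / 2) (c / 10), lt_min (by norm_num) (by positivity), ?_⟩
  intro n k δ hδ hδδ hkn
  suffices h : ENNReal.ofReal (min (1 / 2) (c / 10) * (k * Real.log (1 / δ))) ≤
      (randCCOn (hamPromise n k) δ (hamProblem n k) : ENNReal) from
    ⟨h.trans (ENat.toENNReal_mono (randCCOn_mono (Set.subset_univ _) _ _)), h⟩
  refine ofReal_le_randCCOn fun P herr C hC => ?_
  rcases Nat.eq_zero_or_pos k with rfl | hk
  · simp
  have hlog : 0 ≤ Real.log (1 / δ) := Real.log_nonneg (by rw [le_div_iff₀ hδ]; linarith)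
  rcases le_or_gt δ (1 / 1024) with h | h
  · refine le_trans ?_ (P.cost_ge_of_small_error hC herr hk hδ h hkn)
    gcongr
    exact min_le_left _ _
  · have hlog10 : Real.log (1 / δ) ≤ 10 := by
      have h1 : 1 / δ ≤ 2 ^ 10 := by rw [div_le_iff₀ hδ]; linarith
      have := Real.log_le_log (by positivity) h1
      rw [Real.log_pow] at this
      push_cast at this
      linarith [Real.log_two_lt_d9]
    calc min (1 / 2) (c / 10) * (k * Real.log (1 / δ)) ≤ c / 10 * (k * 10) := by
          gcongr
          exact min_le_right _ _
      _ = c * k := by ring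
      _ ≤ C := hbound n k δ P C hk hδ hδδ hkn hC herr
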